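/- Consider the quadratic vector field $v_\lambda(z)=\mu z+Az^2+Bz\bar z+C\bar z^2$ on $\mathbb C=\mathbb R^2$, where $\mu=\lambda_1+i$, $\lambda_1\ge 0$, $A,B,C\in\mathbb C$, and suppose that it is \emph{normalized}: $|A|\le 1$, $|B|\le 2$, $|C|\le 1$, and at least one of $A=1$, $B=2$, $C=1$ holds. Write $v_\lambda=v_s+u$, where $v_s(z)=\mu z\,(az+\bar a\bar z+1)$ with $a=A/\mu$, and $u=bz\bar z+c\bar z^2$ with $b=B-\frac{\mu}{\bar\mu}\bar A$, $c=C$. Let $\kappa>0$ and suppose that $v_\lambda$ is $\kappa$-\emph{distant from singular quadratic vector fields}, i.e. $\sqrt{|b|^2+|c|^2}>\kappa$. (For $A=1$ one has $b=B-\mu/\bar\mu$; if $\kappa<1$, every normalized field with $A\ne 1$ satisfies the condition.) For $0<\delta<1$ let $B(\lambda,\delta)$ be the disc $|z|\le\delta^{-1}$ minus the open $\delta$-neighbourhoods in $\mathbb C^2$ of all singular points of $v_\lambda$ other than $0$, both real and complex (a complex singular point is a common zero in $\mathbb C^2\supset\mathbb R^2$ of the two real polynomial components of $v_\lambda$). A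 limit cycle (isolated closed orbit) of $v_\lambda$ is $\delta$-\emph{tame} if it is contained in $B(\lambda,\delta)$. In polar coordinates $z=re^{i\theta}$, $r\ge 0$, one has $\dot\theta=1+rg_\lambda(\theta)$ with $$g_\lambda(\theta)=\operatorname{Im}\left(Ae^{i\theta}+Be^{-i\theta}+Ce^{-3i\theta}\right).$$ Lemma (Second Main Lemma). Under these assumptions, no $\delta$-tame limit cycle of $v_\lambda$ that surrounds the origin meets the curvilinear strip $$\Pi_\beta=\left\{re^{i\theta}\in B(\lambda,\delta)\ :\ r\ge 0,\ g_\lambda(\theta)\neq 0,\ -\frac1{g_\lambda(\theta)}-\beta\le r\le-\frac1{g_\lambda(\theta)}\right\},\qquad \beta=\frac{\delta^{14}\kappa}{10^{10}}.$$ -/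

import Mathlib

open scoped ComplexConjugate

noncomputable section

/-- Parameters `(l₁, A, B, C)` of a planar quadratic field `z' = (l₁ + i) z + A z² + B z z̄ + C z̄²`. -/
structure QuadParam where
  l₁ : ℝ
  A : ℂ
  B : ℂ
  C : ℂ

namespace QuadParam

/-- The linear coefficient `μ = l₁ + i`. -/
def mu (p : QuadParam) : ℂ := (p.l₁ : ℂ) + Complex.I

/-- The quadratic vector field on the plane `ℂ = ℝ²`. -/
def field (p : QuadParam) (z : ℂ) : ℂ :=
  p.mu * z + p.A * z ^ 2 + p.B * (z * conj z) + p.C * (conj z) ^ 2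

/-- Normalized parameters: `l₁ ≥ 0`, and `(A, B, C)` lies in the polydisc `|A| ≤ 1, |B| ≤ 2, |C| ≤ 1`
with `A = 1`, or `B = 2`, or `C = 1`. -/
def IsNormalized (p : QuadParam) : Prop :=
  0 ≤ p.l₁ ∧
    ((p.A = 1 ∧ ‖p.B‖ ≤ 2 ∧ ‖p.C‖ ≤ 1) ∨
     (p.B = 2 ∧ ‖p.A‖ ≤ 1 ∧ ‖p.C‖ ≤ 1) ∨
     (p.C = 1 ∧ ‖p.A‖ ≤ 1 ∧ ‖p.B‖ ≤ 2))

/-- `(x, y) ∈ ℂ²` is a singular point of the complexified field. With `ζ = x + i y`, `η = x - i y`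
(which are `z` and `z̄` when `x, y` are real), the two equations say that the polynomial
components of the field, continued to `ℂ²`, both vanish at `(x, y)`. -/
def IsSingularPoint (p : QuadParam) (x y : ℂ) : Prop :=
  p.mu * (x + Complex.I * y) + p.A * (x + Complex.I * y) ^ 2
      + p.B * ((x + Complex.I * y) * (x - Complex.I * y)) + p.C * (x - Complex.I * y) ^ 2 = 0 ∧
    conj p.mu * (x - Complex.I * y) + conj p.A * (x - Complex.I * y) ^ 2
      + conj p.B * ((x + Complex.I * y) * (x - Complex.I * y))
      + conj p.C * (x + Complex.I * y) ^ 2 = 0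

/-- The real singular points of the complexified field are the zeros of the field. -/
theorem isSingularPoint_ofReal (p : QuadParam) (z : ℂ) :
    p.IsSingularPoint (z.re : ℂ) (z.im : ℂ) ↔ p.field z = 0 := by
  have h1 : (z.re : ℂ) + Complex.I * (z.im : ℂ) = z := by
    rw [mul_comm]; exact Complex.re_add_im z
  have h2 : (z.re : ℂ) - Complex.I * (z.im : ℂ) = conj z := by
    apply Complex.ext <;> simp
  have h3 : conj p.mu * conj z + conj p.A * (conj z) ^ 2 + conj p.B * (z * conj z)
      + conj p.C * z ^ 2 = conj (p.field z) := by
    simp only [field, map_add, map_mul, map_pow, Complex.conj_conj]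
    ring
  unfold IsSingularPoint
  rw [h1, h2, h3]
  constructor
  · intro h; exact h.1
  · intro h; exact ⟨h, by rw [h, map_zero]⟩

/-- `B(p, δ)`: the closed disc of radius `1/δ` minus the open `δ`-neighbourhoods (in `ℂ²`, with its
Hermitian distance) of all singular points, real and complex, other than the origin. -/
def tameDomain (p : QuadParam) (δ : ℝ) : Set ℂ :=
  {z | ‖z‖ ≤ δ⁻¹ ∧ ∀ x y : ℂ, p.IsSingularPoint x y → (x, y) ≠ (0, 0) →
    δ ≤ Real.sqrt (‖(z.re : ℂ) - x‖ ^ 2 + ‖(z.im : ℂ) - y‖ ^ 2)}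

/-- `h(θ) = A e^{iθ} + B e^{-iθ} + C e^{-3iθ}`. -/
def h (p : QuadParam) (θ : ℝ) : ℂ :=
  p.A * Complex.exp (Complex.I * θ) + p.B * Complex.exp (-(Complex.I * θ))
    + p.C * Complex.exp (-(3 * (Complex.I * θ)))

/-- `g = Im h`, so that `θ' = 1 + r g(θ)` in polar coordinates. -/
def g (p : QuadParam) (θ : ℝ) : ℝ := (p.h θ).im

/-- The polar form of the field: `v(z) / z = μ + r h(θ)` at `z = r e^{iθ}`. -/
theorem field_polar (p : QuadParam) (r θ : ℝ) :
    p.field (r * Complex.exp (Complex.I * θ))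
      = (r * Complex.exp (Complex.I * θ)) * (p.mu + r * p.h θ) := by
  have hc : conj (Complex.exp (Complex.I * θ)) = (Complex.exp (Complex.I * θ))⁻¹ := by
    rw [← Complex.exp_conj, ← Complex.exp_neg]; simp
  have h3 : Complex.exp (-(3 * (Complex.I * θ))) = ((Complex.exp (Complex.I * θ))⁻¹) ^ 3 := by
    rw [← Complex.exp_neg, ← Complex.exp_nat_mul]; congr 1; push_cast; ring
  have hne := Complex.exp_ne_zero (Complex.I * θ)
  simp only [field, h, map_mul, Complex.conj_ofReal, hc, h3, Complex.exp_neg]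
  field_simp
  ring

/-- The curvilinear strip `-1/g(θ) - β ≤ r ≤ -1/g(θ)` inside `B(p, δ)`, in polar coordinates. -/
def strip (p : QuadParam) (δ β : ℝ) : Set ℂ :=
  {z | z ∈ p.tameDomain δ ∧ ∃ r θ : ℝ, 0 ≤ r ∧ z = r * Complex.exp (Complex.I * θ) ∧
    p.g θ ≠ 0 ∧ -1 / p.g θ - β ≤ r ∧ r ≤ -1 / p.g θ}

/-- The singular field `μ z (a z + ā z̄ + 1)` with line of singular points `a z + ā z̄ + 1 = 0`. -/
def singularField (μ a : ℂ) (z : ℂ) : ℂ := μ * z * (a * z + conj a * conj z + 1)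

/-- The coefficient `b` of `z z̄` in the decomposition `v = v_s + b z z̄ + c z̄²`, where `v_s` is the
singular field with the same linear and `z²` terms as `v`. If `A = 1` then `b = B - μ / μ̄`. -/
def devB (p : QuadParam) : ℂ := p.B - p.mu / conj p.mu * conj p.A

theorem mu_ne_zero (p : QuadParam) : p.mu ≠ 0 := by
  intro h0
  have := congrArg Complex.im h0
  simp [mu] at this

/-- The decomposition `v = v_s + u`, `u = b z z̄ + c z̄²`. -/
theorem field_eq_singularField_add (p : QuadParam) (z : ℂ) :
    p.field z = singularField p.mu (p.A / p.mu) z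
      + (p.devB * (z * conj z) + p.C * (conj z) ^ 2) := by
  have h1 := p.mu_ne_zero
  have h2 : conj p.mu ≠ 0 := by simpa using h1
  simp only [field, singularField, devB, map_div₀]
  field_simp
  ring

/-- `κ`-distant from singular fields: `‖r⁻² u‖₂ = √(|b|² + |c|²) > κ`, with `c = C`. -/
def IsDistantFromSingular (p : QuadParam) (κ : ℝ) : Prop :=
  κ < Real.sqrt (‖p.devB‖ ^ 2 + ‖p.C‖ ^ 2)

theorem isDistantFromSingular_of_A_eq_one (p : QuadParam) (κ : ℝ) (hA : p.A = 1) :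
    p.IsDistantFromSingular κ ↔ κ < Real.sqrt (‖p.B - p.mu / conj p.mu‖ ^ 2 + ‖p.C‖ ^ 2) := by
  simp [IsDistantFromSingular, devB, hA]

/-- For `κ < 1`, the condition restricts only the normal form with `A = 1`: the two other normal
forms are always `κ`-distant from singular fields. -/
theorem isDistantFromSingular_of_A_ne_one (p : QuadParam) (κ : ℝ) (hp : p.IsNormalized)
    (hκ : κ < 1) (hA : p.A ≠ 1) : p.IsDistantFromSingular κ := by
  refine hκ.trans_le (Real.one_le_sqrt.mpr ?_)
  have hm : ‖p.mu / conj p.mu‖ = 1 := by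
    rw [norm_div, Complex.norm_conj, div_self (norm_ne_zero_iff.mpr p.mu_ne_zero)]
  rcases hp.2 with h1 | ⟨hB, h1, -⟩ | ⟨hC, -, -⟩
  · exact absurd h1.1 hA
  · have h2 : ‖p.B‖ - ‖p.mu / conj p.mu * conj p.A‖ ≤ ‖p.devB‖ := norm_sub_norm_le _ _
    rw [norm_mul, hm, Complex.norm_conj, hB] at h2
    norm_num at h2
    nlinarith [sq_nonneg ‖p.C‖]
  · rw [hC]; norm_num

end QuadParam

/-- `L` is a closed orbit of `v`: the image of a nonconstant periodic solution of `z' = v(z)`. -/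
def IsClosedOrbit (v : ℂ → ℂ) (L : Set ℂ) : Prop :=
  ∃ (γ : ℝ → ℂ) (T : ℝ), 0 < T ∧ (∀ t, HasDerivAt γ (v (γ t)) t) ∧ (∀ t, γ (t + T) = γ t) ∧
    (∃ t, γ t ≠ γ 0) ∧ Set.range γ = L

/-- A limit cycle: a closed orbit with a neighbourhood that contains no other closed orbit. -/
def IsLimitCycle (v : ℂ → ℂ) (L : Set ℂ) : Prop :=
  IsClosedOrbit v L ∧
    ∃ U : Set ℂ, IsOpen U ∧ L ⊆ U ∧ ∀ L' : Set ℂ, IsClosedOrbit v L' → L' ⊆ U → L' = L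

/-- `L` surrounds `z`: `z` lies in a bounded component of the complement of `L`. -/
def Surrounds (L : Set ℂ) (z : ℂ) : Prop :=
  z ∉ L ∧ Bornology.IsBounded (connectedComponentIn Lᶜ z)

/-- `L` is a `δ`-tame limit cycle of the field `p`. -/
def IsTameLimitCycle (p : QuadParam) (δ : ℝ) (L : Set ℂ) : Prop :=
  IsLimitCycle p.field L ∧ L ⊆ p.tameDomain δ

end

/-!
On the strip `0 ≤ θ' ≤ 4β`, as `|g| ≤ 4`, so it suffices that `θ' > 4β` along the orbit.

The complex singular points other than `0` lie on the lines `z̄ = k z`, where `k` runs over the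
roots of a cubic whose coefficients have `ℓ²` norm at least `κ`. If `v(z) / z` is small at a tame
point `z`, then `z̄ / z` is far from these roots, so the cubic is not small there; but at `z̄ / z`
it is bounded by `2 |v(z) / z| / |z|`. Hence `|v(z) / z| ≥ c δ⁹ κ` away from `0`, with an absolute
constant `c`. The real and imaginary parts of `v(z) / z` are `r' / r` and `θ'`, so where `θ'` is
small `r' / r` is not, and `θ'' ≈ -r' / r ≠ 0`.

The orbit meets a ray on which `g = 0`, where `θ' = 1`; it crosses that angle only upwards, hence
never returns to it. If `θ'` vanished for the first time at `t₁`, the orbit would turn back, at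
larger radii than on the arc just traversed, because on a given ray `θ' ≤ 0` forces `θ' < 0` farther
out. Being simple it stays outside that arc until it reaches the angle `θ(t₁)` again, at a radius
larger than `r(t₁)`, where `θ' < 0`: it cannot reach that angle from below. So `θ' > 0`, and at the
minimum of `θ'` over a period `θ'' = 0`, so this minimum is not small.
-/

section PolarCurves

open Filter Set Topology

theorem exists_first_hit {f : ℝ → ℝ} {a b y : ℝ} (hab : a ≤ b) (hf : ContinuousOn f (Icc a b))
    (ha : f a < y) (hb : y ≤ f b) : ∃ c ∈ Ioc a b, f c = y ∧ ∀ t ∈ Ico a c, f t < y := by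
  have hcompact : IsCompact (Icc a b ∩ f ⁻¹' Ici y) :=
    isCompact_Icc.of_isClosed_subset (hf.preimage_isClosed_of_isClosed isClosed_Icc isClosed_Ici)
      inter_subset_left
  obtain ⟨c, ⟨hc, hyc⟩, hleast⟩ := hcompact.exists_isLeast ⟨b, ⟨hab, le_rfl⟩, hb⟩
  obtain ⟨c', hc', rfl⟩ := intermediate_value_Icc hc.1 (hf.mono (Icc_subset_Icc_right hc.2))
    ⟨ha.le, hyc⟩
  have hcc' : c = c' := le_antisymm (hleast ⟨⟨hc'.1, hc'.2.trans hc.2⟩, le_refl (f c')⟩) hc'.2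
  subst hcc'
  have hac : a < c := hc.1.lt_of_ne (by rintro rfl; exact ha.false)
  refine ⟨c, ⟨hac, hc.2⟩, rfl, fun t ht => ?_⟩
  by_contra! hct
  exact (hleast ⟨⟨ht.1, ht.2.le.trans hc.2⟩, hct⟩).not_gt ht.2

theorem nonneg_of_hasDerivAt_of_forall_le {f : ℝ → ℝ} {f' b c : ℝ} (hf : HasDerivAt f f' c)
    (hbc : b < c) (hle : ∀ t ∈ Ico b c, f t ≤ f c) : 0 ≤ f' := by
  have hslope : Tendsto (slope f c) (𝓝[<] c) (𝓝 f') :=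
    (hasDerivAt_iff_tendsto_slope.mp hf).mono_left (nhdsWithin_mono c fun _ h => ne_of_lt h)
  refine ge_of_tendsto hslope ?_
  filter_upwards [Ico_mem_nhdsLT hbc] with t ht
  rw [slope_comm]
  exact (slope_nonneg_iff_of_le ht.2.le).mpr (hle t ht)

theorem lt_of_hasDerivAt_pos_on_level {f f' : ℝ → ℝ} (hf : ∀ t, HasDerivAt f (f' t) t) {a : ℝ}
    (ha : ∀ t, f t = a → 0 < f' t) {s t : ℝ} (hs : a ≤ f s) (hst : s < t) : a < f t := by
  have hle : ∀ x ∈ Icc s t, a ≤ f x := by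
    have := image_le_of_deriv_right_lt_deriv_boundary (f := fun _ => a) (f' := 0)
      (B := f) (B' := f') (a := s) (b := t) continuousOn_const
      (fun x _ => hasDerivWithinAt_const _ _ _) hs hf (fun x _ h => ha x h.symm)
    exact fun x hx => this hx
  refine (hle t ⟨hst.le, le_rfl⟩).lt_of_ne fun hat => (ha t hat.symm).not_ge ?_
  have := nonneg_of_hasDerivAt_of_forall_le (hf t).neg hst fun x hx =>
    neg_le_neg (hat ▸ hle x ⟨hx.1, hx.2.le⟩)
  linarith

theorem continuousOn_of_comp_injOn {X Y Z : Type*} [TopologicalSpace X] [TopologicalSpace Y]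
    [TopologicalSpace Z] [T2Space Z] {f : Y → Z} {K : Set Y} (hK : IsCompact K)
    (hf : ContinuousOn f K) (hinj : InjOn f K) {σ : X → Y} {s : Set X} (hσ : MapsTo σ s K)
    (hcomp : ContinuousOn (f ∘ σ) s) : ContinuousOn σ s := by
  have : CompactSpace K := isCompact_iff_compactSpace.mp hK
  have hemb : IsClosedEmbedding (K.domRestrict f) :=
    (continuousOn_iff_continuous_domRestrict.mp hf).isClosedEmbedding (injOn_iff_injective.mp hinj)
  have hlift : Continuous hσ.restrict :=
    hemb.isInducing.continuous_iff.mpr (continuousOn_iff_continuous_domRestrict.mp hcomp)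
  exact continuousOn_iff_continuous_domRestrict.mpr (continuous_subtype_val.comp hlift)

theorem radius_lt_of_radius_lt {θ r : ℝ → ℝ} (hθ : Continuous θ) (hr : Continuous r)
    (hinj : Function.Injective fun t => (θ t, r t)) {a m b c : ℝ}
    (hmono : StrictMonoOn θ (Icc a m)) (hmb : m < b) (hbc : b ≤ c)
    (hmaps : MapsTo θ (Icc b c) (Icc (θ a) (θ m))) {s s' : ℝ} (hs : s ∈ Icc a m)
    (hs' : s' ∈ Icc a m) (hsb : θ s = θ b) (hs'c : θ s' = θ c) (hr_lt : r s < r b) :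
    r s' < r c := by
  have hsection : ∀ t ∈ Icc b c, ∃ x ∈ Icc a m, θ x = θ t := fun t ht =>
    intermediate_value_Icc (hs.1.trans hs.2) hθ.continuousOn (hmaps ht)
  choose! σ hσ hθσ using hsection
  have hσ_cont : ContinuousOn σ (Icc b c) :=
    continuousOn_of_comp_injOn isCompact_Icc hθ.continuousOn hmono.injOn hσ
      (hθ.continuousOn.congr hθσ)
  have hgap_ne : ∀ t ∈ Icc b c, r t - r (σ t) ≠ 0 := fun t ht hzero => by
    have heq : σ t = t := hinj (Prod.ext (hθσ t ht) (sub_eq_zero.mp hzero).symm)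
    linarith [(hσ t ht).2, ht.1]
  have hb : b ∈ Icc b c := ⟨le_rfl, hbc⟩
  have hc : c ∈ Icc b c := ⟨hbc, le_rfl⟩
  have hσb : σ b = s := hmono.injOn (hσ b hb) hs ((hθσ b hb).trans hsb.symm)
  have hσc : σ c = s' := hmono.injOn (hσ c hc) hs' ((hθσ c hc).trans hs'c.symm)
  by_contra! hle
  obtain ⟨t, ht, hzero⟩ := intermediate_value_Icc' hbc
    (hr.continuousOn.sub (hr.comp_continuousOn hσ_cont))
    (show (0 : ℝ) ∈ Icc (r c - r (σ c)) (r b - r (σ b)) by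
      rw [hσb, hσc]; exact ⟨sub_nonpos.mpr hle, (sub_pos.mpr hr_lt).le⟩)
  exact hgap_ne t ht hzero

variable {θ r w w' : ℝ → ℝ}

theorem exists_backward_arc (hθ : ∀ t, HasDerivAt θ (w t) t) {t₁ v : ℝ} (hw : HasDerivAt w v t₁)
    (hzero : w t₁ = 0) (hv : v < 0) :
    ∃ b > t₁, w b < 0 ∧ ∀ t ∈ Ioc t₁ b, θ t < θ t₁ := by
  have hneg : ∀ᶠ t in 𝓝[>] t₁, w t < 0 := by
    have hslope : Tendsto (slope w t₁) (𝓝[>] t₁) (𝓝 v) :=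
      (hasDerivAt_iff_tendsto_slope.mp hw).mono_left (nhdsWithin_mono t₁ fun _ h => ne_of_gt h)
    filter_upwards [hslope.eventually (gt_mem_nhds hv), self_mem_nhdsWithin] with t ht htt₁
    rw [← hzero]
    exact (slope_neg_iff_of_le (le_of_lt htt₁)).mp ht
  obtain ⟨b, hb, hwb⟩ := mem_nhdsGT_iff_exists_Ioc_subset.mp hneg
  refine ⟨b, hb, hwb ⟨hb, le_rfl⟩, fun t ht => ?_⟩
  have hanti : StrictAntiOn θ (Icc t₁ b) :=
    strictAntiOn_of_hasDerivWithinAt_neg (convex_Icc _ _)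
      (fun x _ => (hθ x).continuousAt.continuousWithinAt)
      (fun x _ => (hθ x).hasDerivWithinAt)
      (fun x hx => hwb (Ioo_subset_Ioc_self (interior_Icc (a := t₁) ▸ hx)))
  exact hanti ⟨le_rfl, hb.le⟩ ⟨ht.1.le, ht.2⟩ ht.1

theorem angle_lt_of_turned_back (hθ : ∀ t, HasDerivAt θ (w t) t) (hr : Continuous r)
    (hinj : Function.Injective fun t => (θ t, r t))
    (hout : ∀ s t, θ s = θ t → r s < r t → w s ≤ 0 → w t < 0)
    {a t₁ b u : ℝ} (hret : ∀ t > a, θ a < θ t) (hat₁ : a < t₁) (hpos : ∀ t ∈ Ico a t₁, 0 < w t)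
    (hzero : w t₁ = 0) (hb : t₁ < b) (hwb : w b < 0) (hθb : θ b < θ t₁)
    (hbu : b ≤ u) : θ u < θ t₁ := by
  by_contra! hθu
  have hθc : Continuous θ := continuous_iff_continuousAt.mpr fun t => (hθ t).continuousAt
  have hmono : StrictMonoOn θ (Icc a t₁) :=
    strictMonoOn_of_hasDerivWithinAt_pos (convex_Icc _ _) hθc.continuousOn
      (fun x _ => (hθ x).hasDerivWithinAt)
      (fun x hx => hpos x (Ioo_subset_Ico_self (interior_Icc (a := a) ▸ hx)))
  obtain ⟨c, ⟨hbc, -⟩, hθcc, hbefore⟩ := exists_first_hit hbu hθc.continuousOn hθb hθu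
  have hmaps : MapsTo θ (Icc b c) (Icc (θ a) (θ t₁)) := fun t ht =>
    ⟨(hret t (by linarith [ht.1])).le,
      ht.2.eq_or_lt.elim (fun h => h ▸ hθcc.le) fun h => (hbefore t ⟨ht.1, h⟩).le⟩
  obtain ⟨s, hs, hsb⟩ := intermediate_value_Icc hat₁.le hθc.continuousOn
    (hmaps ⟨le_rfl, hbc.le⟩)
  have hst₁ : s < t₁ := hs.2.lt_of_ne (by rintro rfl; exact hθb.ne hsb.symm)
  have hrsb : r s < r b := by
    by_contra! hle
    have hne : r b ≠ r s := fun h => (hst₁.trans hb).ne (hinj (Prod.ext hsb h.symm))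
    exact (hpos s ⟨hs.1, hst₁⟩).not_gt (hout b s hsb.symm (hle.lt_of_ne hne) hwb.le)
  have hrt₁c : r t₁ < r c := radius_lt_of_radius_lt hθc hr hinj hmono hb hbc.le hmaps hs
    ⟨hat₁.le, le_rfl⟩ hsb hθcc.symm hrsb
  have hwc : w c < 0 := hout t₁ c hθcc.symm hrt₁c hzero.le
  exact hwc.not_ge (nonneg_of_hasDerivAt_of_forall_le (hθ c) hbc fun t ht =>
    (hbefore t ht).le.trans hθcc.ge)

theorem angularVelocity_pos_of_forall_lt (hθ : ∀ t, HasDerivAt θ (w t) t)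
    (hw : ∀ t, HasDerivAt w (w' t) t) (hr : Continuous r)
    (hinj : Function.Injective fun t => (θ t, r t))
    (hout : ∀ s t, θ s = θ t → r s < r t → w s ≤ 0 → w t < 0)
    (hreg : ∀ t, w t = 0 → w' t ≠ 0) {a : ℝ} (ha : 0 < w a) (hret : ∀ t > a, θ a < θ t)
    (hadv : ∀ t, ∃ u > t, θ t ≤ θ u) {t : ℝ} (hat : a ≤ t) : 0 < w t := by
  by_contra! hwt
  have hwc : Continuous w := continuous_iff_continuousAt.mpr fun t => (hw t).continuousAt
  obtain ⟨t₁, ⟨hat₁, -⟩, hzero, hbefore⟩ :=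
    exists_first_hit (f := fun t => -w t) (y := 0) hat hwc.neg.continuousOn (by linarith)
      (by linarith)
  replace hzero : w t₁ = 0 := neg_eq_zero.mp hzero
  have hpos : ∀ t ∈ Ico a t₁, 0 < w t := fun t ht => neg_neg_iff_pos.mp (hbefore t ht)
  have hw'nonpos : 0 ≤ -w' t₁ := nonneg_of_hasDerivAt_of_forall_le (hw t₁).neg hat₁ fun t ht => by
    have := hpos t ht
    simp only [Pi.neg_apply]
    linarith
  have hw'neg : w' t₁ < 0 := (neg_nonneg.mp hw'nonpos).lt_of_ne (hreg t₁ hzero)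
  obtain ⟨b, hb, hwb, hback⟩ := exists_backward_arc hθ (hw t₁) hzero hw'neg
  obtain ⟨u, hu, hθu⟩ := hadv t₁
  rcases le_total u b with hub | hbu
  · exact (hback u ⟨hu, hub⟩).not_ge hθu
  · exact (angle_lt_of_turned_back hθ hr hinj hout hret hat₁ hpos hzero hb hwb
      (hback b ⟨hb, le_rfl⟩) hbu).not_ge hθu

end PolarCurves

theorem norm_eval_le_of_forall_le_norm_sub_roots {K : Type*} [NormedField K] {f : Polynomial K}
    (hf : f.Splits) {d : ℝ} (hd : 0 < d) {x : K} (hroots : ∀ k ∈ f.roots, d ≤ ‖x - k‖) (y : K) :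
    ‖f.eval y‖ ≤ ‖f.eval x‖ * (1 + ‖y - x‖ / d) ^ f.natDegree := by
  have hfactor : ∀ k ∈ f.roots, ‖y - k‖ ≤ ‖x - k‖ * (1 + ‖y - x‖ / d) := fun k hk => by
    have hscale : ‖y - x‖ ≤ ‖x - k‖ * (‖y - x‖ / d) := by
      rw [mul_div_assoc', le_div_iff₀ hd, mul_comm ‖x - k‖]
      exact mul_le_mul_of_nonneg_left (hroots k hk) (norm_nonneg _)
    linarith [norm_sub_le_norm_sub_add_norm_sub y x k]
  have hnorm (z : K) :
      ‖f.eval z‖ = ‖f.leadingCoeff‖ * (f.roots.map fun k => ‖z - k‖).prod := by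
    rw [hf.eval_eq_prod_roots, norm_mul, ← normHom_apply, ← normHom_apply, map_multiset_prod,
      Multiset.map_map]
    rfl
  calc ‖f.eval y‖
      ≤ ‖f.leadingCoeff‖ * (f.roots.map fun k => ‖x - k‖ * (1 + ‖y - x‖ / d)).prod := by
        rw [hnorm]
        gcongr
        exact Multiset.prod_map_le_prod_map₀ _ _ (fun k _ => norm_nonneg _) hfactor
    _ = ‖f.eval x‖ * (1 + ‖y - x‖ / d) ^ f.natDegree := by
        rw [hnorm, Multiset.prod_map_mul, Multiset.map_const', Multiset.prod_replicate,
          ← hf.natDegree_eq_card_roots, mul_assoc]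

theorem exists_norm_eq_one_le_norm_cubic (a b c d : ℂ) :
    ∃ k : ℂ, ‖k‖ = 1 ∧ ‖a‖ ^ 2 + ‖b‖ ^ 2 + ‖c‖ ^ 2 + ‖d‖ ^ 2
      ≤ ‖a * k ^ 3 + b * k ^ 2 + c * k + d‖ ^ 2 := by
  -- The mean of the right-hand side over the four fourth roots of unity is the left-hand side.
  by_contra! hlt
  have hone := hlt 1 (by simp)
  have hneg_one := hlt (-1) (by simp)
  have hI := hlt Complex.I (by simp)
  have hneg_I := hlt (-Complex.I) (by simp)
  rw [show a * 1 ^ 3 + b * 1 ^ 2 + c * 1 + d = d + b + (c + a) by ring] at hone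
  rw [show a * (-1) ^ 3 + b * (-1) ^ 2 + c * (-1) + d = d + b - (c + a) by ring] at hneg_one
  rw [show a * Complex.I ^ 3 + b * Complex.I ^ 2 + c * Complex.I + d
      = d - b + Complex.I * (c - a) by
    linear_combination (a * Complex.I + b) * Complex.I_sq] at hI
  rw [show a * (-Complex.I) ^ 3 + b * (-Complex.I) ^ 2 + c * (-Complex.I) + d
      = d - b - Complex.I * (c - a) by
    linear_combination (-a * Complex.I + b) * Complex.I_sq] at hneg_I
  have hreal := parallelogram_law_with_norm ℝ (d + b) (c + a)
  have himag := parallelogram_law_with_norm ℝ (d - b) (Complex.I * (c - a))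
  rw [norm_mul, Complex.norm_I, one_mul] at himag
  linarith [parallelogram_law_with_norm ℝ d b, parallelogram_law_with_norm ℝ c a]

theorem norm_conj_div_self {z : ℂ} (hz : z ≠ 0) : ‖conj z / z‖ = 1 := by
  rw [norm_div, Complex.norm_conj, div_self (norm_ne_zero_iff.mpr hz)]

namespace QuadParam

/-- The parameters lie in the polydisc `|A| ≤ 1`, `|B| ≤ 2`, `|C| ≤ 1`, from which all bounds on
the coefficients of the field are drawn. -/
structure InPolydisc (p : QuadParam) : Prop where
  norm_A_le : ‖p.A‖ ≤ 1
  norm_B_le : ‖p.B‖ ≤ 2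
  norm_C_le : ‖p.C‖ ≤ 1

theorem IsNormalized.inPolydisc {p : QuadParam} (hp : p.IsNormalized) : p.InPolydisc := by
  rcases hp.2 with ⟨h₁, h₂, h₃⟩ | ⟨h₁, h₂, h₃⟩ | ⟨h₁, h₂, h₃⟩ <;> constructor <;> simp [*]

/-- The coefficient `H(k) = A + B k + C k²` of the first component `μ ζ + H(k) ζ²` of the
complexified field on the complex line `η = k ζ`, where `ζ = x + i y` and `η = x - i y`. -/
noncomputable def lineCoeff (p : QuadParam) (k : ℂ) : ℂ := p.A + p.B * k + p.C * k ^ 2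

/-- The `ζ`-coordinate of the zero other than `0` of the first component of the complexified field
on the line `η = k ζ`; the junk value `0` stands for a zero at infinity. -/
noncomputable def lineZero (p : QuadParam) (k : ℂ) : ℂ := -p.mu / p.lineCoeff k

/-- The cubic whose roots are the slopes `k` of the complex lines `η = k ζ` through the origin that
contain another singular point, possibly at infinity. -/
noncomputable def slopeCubic (p : QuadParam) : Polynomial ℂ :=
  Polynomial.C p.C * Polynomial.X ^ 3 + Polynomial.C p.devB * Polynomial.X ^ 2
    + Polynomial.C (-(p.mu / conj p.mu * conj p.devB)) * Polynomial.X
    + Polynomial.C (-(p.mu / conj p.mu * conj p.C))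

/-- The logarithmic velocity `v(z) / z = r' / r + i θ'`. -/
noncomputable def logVel (p : QuadParam) (z : ℂ) : ℂ := p.field z / z

variable {p : QuadParam}

theorem conj_mu_ne_zero (p : QuadParam) : conj p.mu ≠ 0 := by simpa using p.mu_ne_zero

theorem one_le_norm_mu (p : QuadParam) : 1 ≤ ‖p.mu‖ := by
  simpa [mu] using Complex.abs_im_le_norm p.mu

theorem norm_mu_div_conj_mu (p : QuadParam) : ‖p.mu / conj p.mu‖ = 1 := by
  rw [norm_div, Complex.norm_conj, div_self (norm_ne_zero_iff.mpr p.mu_ne_zero)]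

theorem IsDistantFromSingular.lt_four {κ : ℝ} (hdist : p.IsDistantFromSingular κ)
    (hp : p.InPolydisc) : κ < 4 := by
  refine hdist.trans_le (Real.sqrt_le_iff.mpr ⟨by norm_num, ?_⟩)
  have hdevB : ‖p.devB‖ ≤ 3 := by
    calc ‖p.devB‖ ≤ ‖p.B‖ + ‖p.mu / conj p.mu * conj p.A‖ := norm_sub_le _ _
      _ = ‖p.B‖ + ‖p.A‖ := by rw [norm_mul, norm_mu_div_conj_mu, Complex.norm_conj, one_mul]
      _ ≤ 3 := by linarith [hp.norm_A_le, hp.norm_B_le]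
  nlinarith [norm_nonneg p.devB, norm_nonneg p.C, hp.norm_C_le]

section SlopeCubic

theorem conj_mu_mul_eval_slopeCubic (p : QuadParam) (k : ℂ) :
    conj p.mu * p.slopeCubic.eval k = conj p.mu * k * p.lineCoeff k
      - p.mu * (conj p.A * k ^ 2 + conj p.B * k + conj p.C) := by
  have hmu := p.mu_ne_zero
  have hmu' := p.conj_mu_ne_zero
  simp only [slopeCubic, Polynomial.eval_add, Polynomial.eval_mul, Polynomial.eval_C,
    Polynomial.eval_pow, Polynomial.eval_X]
  simp only [lineCoeff, devB, map_sub, map_mul, map_div₀, Complex.conj_conj]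
  field_simp
  ring

theorem exists_norm_eq_one_le_norm_slopeCubic {κ : ℝ} (hκ : 0 ≤ κ)
    (hdist : p.IsDistantFromSingular κ) : ∃ k : ℂ, ‖k‖ = 1 ∧ κ ≤ ‖p.slopeCubic.eval k‖ := by
  obtain ⟨k, hk, hle⟩ := exists_norm_eq_one_le_norm_cubic p.C p.devB
    (-(p.mu / conj p.mu * conj p.devB)) (-(p.mu / conj p.mu * conj p.C))
  have heval : p.slopeCubic.eval k = p.C * k ^ 3 + p.devB * k ^ 2
      + -(p.mu / conj p.mu * conj p.devB) * k + -(p.mu / conj p.mu * conj p.C) := by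
    simp [slopeCubic]
  rw [← heval, norm_neg, norm_neg, norm_mul, norm_mul, norm_mu_div_conj_mu, Complex.norm_conj,
    Complex.norm_conj, one_mul, one_mul] at hle
  have hκ_sq : κ ^ 2 < ‖p.devB‖ ^ 2 + ‖p.C‖ ^ 2 := (Real.lt_sqrt hκ).mp hdist
  refine ⟨k, hk, le_of_sq_le_sq ?_ (norm_nonneg _)⟩
  linarith [sq_nonneg ‖p.devB‖, sq_nonneg ‖p.C‖]

theorem logVel_eq (p : QuadParam) {z : ℂ} (hz : z ≠ 0) :
    p.logVel z = p.mu + z * p.lineCoeff (conj z / z) := by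
  unfold logVel field lineCoeff
  field_simp
  ring

theorem norm_slopeCubic_mul_norm_le (p : QuadParam) {z : ℂ} (hz : z ≠ 0) :
    ‖p.slopeCubic.eval (conj z / z)‖ * ‖z‖ ≤ 2 * ‖p.logVel z‖ := by
  have hz' : conj z ≠ 0 := by simpa using hz
  have hidentity : conj p.mu * (p.slopeCubic.eval (conj z / z) * z)
      = conj z / z * (conj p.mu * p.logVel z - p.mu * conj (p.logVel z)) := by
    rw [p.logVel_eq hz, ← mul_assoc, conj_mu_mul_eval_slopeCubic]
    simp only [lineCoeff, map_add, map_mul, map_pow, map_div₀, Complex.conj_conj]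
    field_simp
    ring
  refine le_of_mul_le_mul_left ?_ (norm_pos_iff.mpr p.mu_ne_zero)
  calc ‖p.mu‖ * (‖p.slopeCubic.eval (conj z / z)‖ * ‖z‖)
      = ‖conj p.mu * p.logVel z - p.mu * conj (p.logVel z)‖ := by
        rw [← Complex.norm_conj p.mu, ← norm_mul, ← norm_mul, hidentity, norm_mul,
          norm_conj_div_self hz, one_mul]
    _ ≤ ‖p.mu‖ * ‖p.logVel z‖ + ‖p.mu‖ * ‖p.logVel z‖ := by
        refine (norm_sub_le _ _).trans_eq ?_
        simp only [norm_mul, Complex.norm_conj]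
    _ = ‖p.mu‖ * (2 * ‖p.logVel z‖) := by ring

end SlopeCubic

section SingularPoints

theorem lineZero_ne_zero {k : ℂ} (hk : p.lineCoeff k ≠ 0) : p.lineZero k ≠ 0 :=
  div_ne_zero (neg_ne_zero.mpr p.mu_ne_zero) hk

theorem isSingularPoint_lineZero {k : ℂ} (hroot : p.slopeCubic.eval k = 0)
    (hk : p.lineCoeff k ≠ 0) :
    p.IsSingularPoint ((p.lineZero k + k * p.lineZero k) / 2)
      ((p.lineZero k - k * p.lineZero k) / (2 * Complex.I)) := by
  set ζ := p.lineZero k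
  have hadd : (ζ + k * ζ) / 2 + Complex.I * ((ζ - k * ζ) / (2 * Complex.I)) = ζ := by
    field_simp [Complex.I_ne_zero]
    ring
  have hsub : (ζ + k * ζ) / 2 - Complex.I * ((ζ - k * ζ) / (2 * Complex.I)) = k * ζ := by
    field_simp [Complex.I_ne_zero]
    ring
  have hline : ζ * p.lineCoeff k = -p.mu := div_mul_cancel₀ _ hk
  have hcubic := p.conj_mu_mul_eval_slopeCubic k
  rw [hroot, mul_zero] at hcubic
  unfold IsSingularPoint
  rw [hadd, hsub]
  constructor
  · unfold lineCoeff at hline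
    linear_combination ζ * hline
  · refine (mul_eq_zero.mp (?_ : p.mu * _ = 0)).resolve_left p.mu_ne_zero
    linear_combination ζ ^ 2 * hcubic + conj p.mu * k * ζ * hline

theorem two_mul_sq_le_of_mem_tameDomain {δ : ℝ} (hδ : 0 < δ) {z ζ η : ℂ}
    (hz : z ∈ p.tameDomain δ)
    (hsing : p.IsSingularPoint ((ζ + η) / 2) ((ζ - η) / (2 * Complex.I))) (hζ : ζ ≠ 0) :
    2 * δ ^ 2 ≤ ‖z - ζ‖ ^ 2 + ‖conj z - η‖ ^ 2 := by
  have hne : ((ζ + η) / 2, (ζ - η) / (2 * Complex.I)) ≠ ((0 : ℂ), (0 : ℂ)) := fun h => by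
    rw [Prod.mk.injEq, div_eq_zero_iff, div_eq_zero_iff] at h
    have hadd := h.1.resolve_right two_ne_zero
    have hsub := h.2.resolve_right (by simp)
    exact hζ (by linear_combination (hadd + hsub) / 2)
  have hfar := (Real.le_sqrt' hδ).mp (hz.2 _ _ hsing hne)
  have hre : (z.re : ℂ) - (ζ + η) / 2 = ((z - ζ) + (conj z - η)) / 2 := by
    rw [Complex.re_eq_add_conj]; ring
  have him : (z.im : ℂ) - (ζ - η) / (2 * Complex.I)
      = ((z - ζ) - (conj z - η)) / (2 * Complex.I) := by
    rw [Complex.im_eq_sub_conj]; ring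
  rw [hre, him, norm_div, norm_div, norm_mul, Complex.norm_two, Complex.norm_I] at hfar
  linarith [parallelogram_law_with_norm ℝ (z - ζ) (conj z - η)]

theorem InPolydisc.norm_lineCoeff_sub_le (hp : p.InPolydisc) {k k₀ : ℂ} (hk₀ : ‖k₀‖ = 1)
    (hk : ‖k₀ - k‖ ≤ 1) : ‖p.lineCoeff k - p.lineCoeff k₀‖ ≤ 5 * ‖k₀ - k‖ := by
  have hfactor : p.lineCoeff k - p.lineCoeff k₀ = (p.B + p.C * (k + k₀)) * (k - k₀) := by
    unfold lineCoeff; ring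
  have hk2 : ‖k‖ ≤ 2 := by linarith [norm_sub_norm_le k k₀, norm_sub_rev k k₀]
  rw [hfactor, norm_mul, norm_sub_rev k]
  gcongr
  calc ‖p.B + p.C * (k + k₀)‖ ≤ ‖p.B‖ + ‖p.C‖ * (‖k‖ + ‖k₀‖) := by
        refine (norm_add_le _ _).trans ?_
        rw [norm_mul]
        gcongr
        exact norm_add_le _ _
    _ ≤ 2 + 1 * (2 + 1) := by
        gcongr
        exacts [hp.norm_B_le, hp.norm_C_le, hk₀.le]
    _ = 5 := by norm_num

theorem one_sub_norm_logVel_le (p : QuadParam) {z : ℂ} (hz : z ≠ 0) :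
    1 - ‖p.logVel z‖ ≤ ‖z‖ * ‖p.lineCoeff (conj z / z)‖ := by
  have hmu : ‖p.mu‖ ≤ ‖p.logVel z‖ + ‖z * p.lineCoeff (conj z / z)‖ := by
    have h := norm_sub_le (p.logVel z) (z * p.lineCoeff (conj z / z))
    rwa [p.logVel_eq hz, add_sub_cancel_right, ← p.logVel_eq hz] at h
  rw [norm_mul] at hmu
  linarith [p.one_le_norm_mu]

variable {δ : ℝ} {z k : ℂ}

theorem InPolydisc.le_norm_lineCoeff (hp : p.InPolydisc) (hδ : 0 < δ) (hδ1 : δ < 1) (hz : z ≠ 0)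
    (hzδ : ‖z‖ ≤ δ⁻¹) (hv : ‖p.logVel z‖ ≤ δ ^ 2 / 20) (hk : ‖conj z / z - k‖ ≤ δ ^ 3 / 40) :
    4 / 5 * δ ≤ ‖p.lineCoeff k‖ := by
  have hδ2 : δ ^ 2 ≤ 1 := pow_le_one₀ hδ.le hδ1.le
  have hδ3 : δ ^ 3 ≤ δ := pow_le_of_le_one hδ.le hδ1.le (by norm_num)
  have hcoeff₀ : 19 / 20 * δ ≤ ‖p.lineCoeff (conj z / z)‖ := by
    calc 19 / 20 * δ ≤ (1 - ‖p.logVel z‖) * δ := by gcongr; linarith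
      _ ≤ ‖z‖ * ‖p.lineCoeff (conj z / z)‖ * δ := by gcongr; exact p.one_sub_norm_logVel_le hz
      _ ≤ δ⁻¹ * ‖p.lineCoeff (conj z / z)‖ * δ := by gcongr
      _ = ‖p.lineCoeff (conj z / z)‖ := by field_simp
  have hsub : ‖p.lineCoeff k - p.lineCoeff (conj z / z)‖ ≤ 5 * ‖conj z / z - k‖ :=
    hp.norm_lineCoeff_sub_le (norm_conj_div_self hz) (by linarith)
  linarith [norm_sub_norm_le (p.lineCoeff (conj z / z)) (p.lineCoeff k),
    norm_sub_rev (p.lineCoeff (conj z / z)) (p.lineCoeff k)]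

theorem InPolydisc.norm_sub_lineZero_le (hp : p.InPolydisc) (hδ : 0 < δ) (hδ1 : δ < 1)
    (hz : z ≠ 0) (hzδ : ‖z‖ ≤ δ⁻¹) (hv : ‖p.logVel z‖ ≤ δ ^ 2 / 20)
    (hk : ‖conj z / z - k‖ ≤ δ ^ 3 / 40) : ‖z - p.lineZero k‖ ≤ 3 / 10 * δ := by
  have hcoeff := hp.le_norm_lineCoeff hδ hδ1 hz hzδ hv hk
  have hcoeff_ne : p.lineCoeff k ≠ 0 := norm_pos_iff.mp (by linarith)
  have hδ3 : δ ^ 3 ≤ 1 := pow_le_one₀ hδ.le hδ1.le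
  have hidentity : (z - p.lineZero k) * p.lineCoeff k
      = p.logVel z + z * (p.lineCoeff k - p.lineCoeff (conj z / z)) := by
    rw [p.logVel_eq hz, lineZero, sub_mul, div_mul_cancel₀ _ hcoeff_ne]
    ring
  have hproduct : ‖z - p.lineZero k‖ * (4 / 5 * δ) ≤ 3 / 10 * δ * (4 / 5 * δ) := by
    calc ‖z - p.lineZero k‖ * (4 / 5 * δ) ≤ ‖z - p.lineZero k‖ * ‖p.lineCoeff k‖ := by gcongr
      _ ≤ ‖p.logVel z‖ + ‖z‖ * ‖p.lineCoeff k - p.lineCoeff (conj z / z)‖ := by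
          rw [← norm_mul, hidentity, ← norm_mul]
          exact norm_add_le _ _
      _ ≤ δ ^ 2 / 20 + δ⁻¹ * (5 * (δ ^ 3 / 40)) := by
          gcongr
          refine (hp.norm_lineCoeff_sub_le (norm_conj_div_self hz) (by linarith)).trans ?_
          gcongr
      _ = 7 / 40 * δ ^ 2 := by field_simp; norm_num
      _ ≤ 3 / 10 * δ * (4 / 5 * δ) := by nlinarith [sq_nonneg δ]
  exact le_of_mul_le_mul_right hproduct (by positivity)

theorem InPolydisc.norm_conj_sub_mul_lineZero_le (hp : p.InPolydisc) (hδ : 0 < δ) (hδ1 : δ < 1)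
    (hz : z ≠ 0) (hzδ : ‖z‖ ≤ δ⁻¹) (hv : ‖p.logVel z‖ ≤ δ ^ 2 / 20)
    (hk : ‖conj z / z - k‖ ≤ δ ^ 3 / 40) : ‖conj z - k * p.lineZero k‖ ≤ δ / 2 := by
  have hδ3 : δ ^ 3 ≤ 1 := pow_le_one₀ hδ.le hδ1.le
  have hδ2 : δ ^ 2 ≤ δ := pow_le_of_le_one hδ.le hδ1.le (by norm_num)
  have hk_norm : ‖k‖ ≤ 11 / 10 := by
    linarith [norm_sub_norm_le k (conj z / z), norm_sub_rev k (conj z / z),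
      norm_conj_div_self hz]
  have hidentity : conj z - k * p.lineZero k
      = k * (z - p.lineZero k) + (conj z / z - k) * z := by
    field_simp
    ring
  calc ‖conj z - k * p.lineZero k‖ ≤ ‖k‖ * ‖z - p.lineZero k‖ + ‖conj z / z - k‖ * ‖z‖ := by
        rw [hidentity, ← norm_mul, ← norm_mul]
        exact norm_add_le _ _
    _ ≤ 11 / 10 * (3 / 10 * δ) + δ ^ 3 / 40 * δ⁻¹ := by
        gcongr
        exact hp.norm_sub_lineZero_le hδ hδ1 hz hzδ hv hk
    _ = 33 / 100 * δ + δ ^ 2 / 40 := by field_simp; ring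
    _ ≤ δ / 2 := by linarith

theorem InPolydisc.lt_norm_slope_sub_root (hp : p.InPolydisc) (hδ : 0 < δ) (hδ1 : δ < 1)
    (hz : z ≠ 0) (htame : z ∈ p.tameDomain δ) (hv : ‖p.logVel z‖ ≤ δ ^ 2 / 20)
    (hroot : p.slopeCubic.eval k = 0) : δ ^ 3 / 40 < ‖conj z / z - k‖ := by
  by_contra! hk
  have hcoeff : p.lineCoeff k ≠ 0 :=
    norm_pos_iff.mp (by linarith [hp.le_norm_lineCoeff hδ hδ1 hz htame.1 hv hk])
  have hfar := two_mul_sq_le_of_mem_tameDomain hδ htame (isSingularPoint_lineZero hroot hcoeff)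
    (lineZero_ne_zero hcoeff)
  have hnear : ‖z - p.lineZero k‖ ^ 2 + ‖conj z - k * p.lineZero k‖ ^ 2
      ≤ (3 / 10 * δ) ^ 2 + (δ / 2) ^ 2 := by
    gcongr
    exacts [hp.norm_sub_lineZero_le hδ hδ1 hz htame.1 hv hk,
      hp.norm_conj_sub_mul_lineZero_le hδ hδ1 hz htame.1 hv hk]
  nlinarith [sq_pos_of_pos hδ]

theorem InPolydisc.le_norm_slopeCubic_mul (hp : p.InPolydisc) {κ : ℝ} (hδ : 0 < δ) (hδ1 : δ < 1)
    (hκ : 0 ≤ κ) (hdist : p.IsDistantFromSingular κ) (hz : z ≠ 0) (htame : z ∈ p.tameDomain δ)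
    (hv : ‖p.logVel z‖ ≤ δ ^ 2 / 20) :
    κ ≤ ‖p.slopeCubic.eval (conj z / z)‖ * (81 / δ ^ 3) ^ 3 := by
  obtain ⟨k, hk, hκk⟩ := exists_norm_eq_one_le_norm_slopeCubic hκ hdist
  have hδ3 : δ ^ 3 ≤ 1 := pow_le_one₀ hδ.le hδ1.le
  have hratio : 1 + ‖k - conj z / z‖ / (δ ^ 3 / 40) ≤ 81 / δ ^ 3 := by
    calc 1 + ‖k - conj z / z‖ / (δ ^ 3 / 40) ≤ 1 / δ ^ 3 + 2 / (δ ^ 3 / 40) := by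
          gcongr
          · exact (one_le_div (by positivity)).mpr hδ3
          · linarith [norm_sub_le k (conj z / z), norm_conj_div_self hz]
      _ = 81 / δ ^ 3 := by field_simp; norm_num
  calc κ ≤ ‖p.slopeCubic.eval k‖ := hκk
    _ ≤ ‖p.slopeCubic.eval (conj z / z)‖
          * (1 + ‖k - conj z / z‖ / (δ ^ 3 / 40)) ^ p.slopeCubic.natDegree :=
        norm_eval_le_of_forall_le_norm_sub_roots (IsAlgClosed.splits _) (by positivity)
          (fun k₁ hk₁ => (hp.lt_norm_slope_sub_root hδ hδ1 hz htame hv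
            (Polynomial.isRoot_of_mem_roots hk₁)).le) k
    _ ≤ ‖p.slopeCubic.eval (conj z / z)‖ * (1 + ‖k - conj z / z‖ / (δ ^ 3 / 40)) ^ 3 := by
        gcongr
        · exact le_add_of_nonneg_right (by positivity)
        · exact Polynomial.natDegree_cubic_le
    _ ≤ ‖p.slopeCubic.eval (conj z / z)‖ * (81 / δ ^ 3) ^ 3 := by gcongr

theorem InPolydisc.le_norm_logVel (hp : p.InPolydisc) {κ : ℝ} (hδ : 0 < δ) (hδ1 : δ < 1)
    (hκ : 0 ≤ κ) (hdist : p.IsDistantFromSingular κ) (htame : z ∈ p.tameDomain δ)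
    (hz : 1 / 8 ≤ ‖z‖) : δ ^ 9 * κ / (3 * 10 ^ 7) ≤ ‖p.logVel z‖ := by
  have hz0 : z ≠ 0 := norm_pos_iff.mp (by linarith)
  rcases le_or_gt ‖p.logVel z‖ (δ ^ 2 / 20) with hv | hv
  · have hslope : ‖p.slopeCubic.eval (conj z / z)‖ ≤ 16 * ‖p.logVel z‖ := by
      nlinarith [p.norm_slopeCubic_mul_norm_le hz0, norm_nonneg (p.slopeCubic.eval (conj z / z))]
    calc δ ^ 9 * κ / (3 * 10 ^ 7)
        ≤ δ ^ 9 * (16 * ‖p.logVel z‖ * (81 / δ ^ 3) ^ 3) / (3 * 10 ^ 7) := by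
          gcongr
          exact (hp.le_norm_slopeCubic_mul hδ hδ1 hκ hdist hz0 htame hv).trans (by gcongr)
      _ = 16 * 81 ^ 3 / (3 * 10 ^ 7) * ‖p.logVel z‖ := by field_simp
      _ ≤ ‖p.logVel z‖ := by linarith [norm_nonneg (p.logVel z)]
  · calc δ ^ 9 * κ / (3 * 10 ^ 7) ≤ δ ^ 2 * 4 / (3 * 10 ^ 7) := by
          gcongr ?_ * ?_ / _
          · exact pow_le_pow_of_le_one hδ.le hδ1.le (by norm_num)
          · exact (hdist.lt_four hp).le
      _ ≤ δ ^ 2 / 20 := by linarith [sq_nonneg δ]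
      _ ≤ ‖p.logVel z‖ := hv.le

end SingularPoints

end QuadParam

namespace QuadParam

/-- The derivative of the polar coefficient `h`. -/
noncomputable def hDeriv (p : QuadParam) (θ : ℝ) : ℂ :=
  p.A * (Complex.exp (Complex.I * θ) * Complex.I)
    + p.B * (Complex.exp (-(Complex.I * θ)) * -Complex.I)
    + p.C * (Complex.exp (-(3 * (Complex.I * θ))) * -(3 * Complex.I))

/-- The logarithmic growth rate `r' / r` of the radius, in polar coordinates. -/
noncomputable def radialRate (p : QuadParam) (r θ : ℝ) : ℝ := p.l₁ + r * (p.h θ).re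

/-- The angular velocity `θ'`, in polar coordinates. -/
noncomputable def angularVelocity (p : QuadParam) (r θ : ℝ) : ℝ := 1 + r * p.g θ

/-- The angular acceleration `θ''` along the flow, in polar coordinates. -/
noncomputable def angularAcceleration (p : QuadParam) (r θ : ℝ) : ℝ :=
  r * p.radialRate r θ * p.g θ + r * ((p.hDeriv θ).im * p.angularVelocity r θ)

variable {p : QuadParam}

theorem hasDerivAt_h (p : QuadParam) (θ : ℝ) : HasDerivAt p.h (p.hDeriv θ) θ := by
  have hlin : HasDerivAt (fun x : ℝ => Complex.I * (x : ℂ)) Complex.I θ := by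
    simpa using (Complex.ofRealCLM.hasDerivAt (x := θ)).const_mul Complex.I
  exact ((hlin.cexp.const_mul p.A).add (hlin.neg.cexp.const_mul p.B)).add
    ((hlin.const_mul 3).neg.cexp.const_mul p.C)

theorem hasDerivAt_g (p : QuadParam) (θ : ℝ) : HasDerivAt p.g (p.hDeriv θ).im θ :=
  (Complex.imCLM.hasFDerivAt.comp_hasDerivAt θ (p.hasDerivAt_h θ) :)

theorem InPolydisc.abs_g_le (hp : p.InPolydisc) (θ : ℝ) : |p.g θ| ≤ 4 := by
  refine (Complex.abs_im_le_norm _).trans (norm_add₃_le.trans ?_)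
  have hsum : ‖p.A‖ + ‖p.B‖ + ‖p.C‖ ≤ 4 := by
    linarith [hp.norm_A_le, hp.norm_B_le, hp.norm_C_le]
  simpa [Complex.norm_exp] using hsum

theorem InPolydisc.abs_im_hDeriv_le (hp : p.InPolydisc) (θ : ℝ) : |(p.hDeriv θ).im| ≤ 6 := by
  refine (Complex.abs_im_le_norm _).trans (norm_add₃_le.trans ?_)
  have hsum : ‖p.A‖ + ‖p.B‖ + ‖p.C‖ * 3 ≤ 6 := by
    linarith [hp.norm_A_le, hp.norm_B_le, hp.norm_C_le]
  simpa [Complex.norm_exp] using hsum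

theorem antiperiodic_g (p : QuadParam) : Function.Antiperiodic p.g Real.pi := fun θ => by
  have hexp : Complex.exp (Complex.I * ((θ + Real.pi : ℝ) : ℂ)) = -Complex.exp (Complex.I * θ) := by
    rw [Complex.ofReal_add, mul_add, mul_comm Complex.I (Real.pi : ℂ)]
    exact Complex.exp_antiperiodic _
  have hexp_three (x : ℝ) : Complex.exp (-(3 * (Complex.I * x)))
      = (Complex.exp (Complex.I * x))⁻¹ ^ 3 := by
    rw [← Complex.exp_neg, ← Complex.exp_nat_mul]; congr 1; push_cast; ring
  have hh : p.h (θ + Real.pi) = -p.h θ := by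
    simp only [h, hexp_three, Complex.exp_neg, hexp, inv_neg]
    ring
  rw [g, g, hh, Complex.neg_im]

theorem exists_g_eq_zero (p : QuadParam) : ∃ θ, p.g θ = 0 := by
  have hcont : Continuous p.g := continuous_iff_continuousAt.mpr fun θ =>
    (p.hasDerivAt_g θ).continuousAt
  have hflip : p.g Real.pi = -p.g 0 := by simpa using p.antiperiodic_g 0
  rcases le_total (p.g 0) 0 with h0 | h0
  · exact mem_range_of_exists_le_of_exists_ge hcont ⟨0, h0⟩ ⟨Real.pi, by linarith⟩
  · exact mem_range_of_exists_le_of_exists_ge hcont ⟨Real.pi, by linarith⟩ ⟨0, h0⟩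

theorem logVel_polar (p : QuadParam) {r : ℝ} (hr : r ≠ 0) (θ : ℝ) :
    p.logVel (r * Complex.exp (Complex.I * θ)) = ⟨p.radialRate r θ, p.angularVelocity r θ⟩ := by
  have hz : (r : ℂ) * Complex.exp (Complex.I * θ) ≠ 0 :=
    mul_ne_zero (Complex.ofReal_ne_zero.mpr hr) (Complex.exp_ne_zero _)
  rw [logVel, field_polar, mul_div_cancel_left₀ _ hz]
  apply Complex.ext <;> simp [mu, g, radialRate, angularVelocity]

theorem angularVelocity_eq_one {r θ : ℝ} (hθ : p.g θ = 0) : p.angularVelocity r θ = 1 := by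
  rw [angularVelocity, hθ, mul_zero, add_zero]

theorem angularVelocity_neg_of_lt {r₁ r₂ θ : ℝ} (hr₁ : 0 < r₁) (hr : r₁ < r₂)
    (hw : p.angularVelocity r₁ θ ≤ 0) : p.angularVelocity r₂ θ < 0 := by
  unfold angularVelocity at hw ⊢
  have hg : p.g θ < 0 := by
    by_contra! hg
    linarith [mul_nonneg hr₁.le hg]
  linarith [mul_lt_mul_of_neg_right hr hg]

theorem InPolydisc.eighth_le_of_abs_angularVelocity_le (hp : p.InPolydisc) {r θ : ℝ} (hr : 0 ≤ r)
    (hw : |p.angularVelocity r θ| ≤ 1 / 2) : 1 / 8 ≤ r := by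
  have hrg : r * p.g θ ≥ r * -4 :=
    mul_le_mul_of_nonneg_left (abs_le.mp (hp.abs_g_le θ)).1 hr
  have hw' : 1 + r * p.g θ ≤ 1 / 2 := (abs_le.mp hw).2
  linarith

theorem InPolydisc.abs_radialRate_mul_le (hp : p.InPolydisc) {r θ : ℝ} (hr : 0 ≤ r)
    (hacc : p.angularAcceleration r θ = 0) :
    |p.radialRate r θ| * (1 - |p.angularVelocity r θ|) ≤ 6 * r * |p.angularVelocity r θ| := by
  set ρ := p.radialRate r θ
  set w := p.angularVelocity r θ with hw
  have hsolve : ρ = ρ * w + r * (p.hDeriv θ).im * w := by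
    rw [angularAcceleration, ← hw] at hacc
    rw [angularVelocity] at hw
    linear_combination -hacc - ρ * hw
  have habs : |ρ| ≤ |ρ| * |w| + r * 6 * |w| := by
    calc |ρ| = |ρ * w + r * (p.hDeriv θ).im * w| := congrArg _ hsolve
      _ ≤ |ρ| * |w| + r * |(p.hDeriv θ).im| * |w| := by
          refine (abs_add_le _ _).trans_eq ?_
          simp only [abs_mul, abs_of_nonneg hr]
      _ ≤ |ρ| * |w| + r * 6 * |w| := by gcongr; exact hp.abs_im_hDeriv_le θ
  linarith

theorem InPolydisc.angularAcceleration_ne_zero (hp : p.InPolydisc) {δ κ r θ : ℝ} (hδ : 0 < δ)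
    (hδ1 : δ < 1) (hκ : 0 < κ) (hdist : p.IsDistantFromSingular κ) (hr : 0 < r)
    (htame : (r : ℂ) * Complex.exp (Complex.I * θ) ∈ p.tameDomain δ)
    (hw : |p.angularVelocity r θ| ≤ 4 * (δ ^ 10 * κ / 10 ^ 10)) :
    p.angularAcceleration r θ ≠ 0 := by
  intro hacc
  set c := δ ^ 9 * κ / (3 * 10 ^ 7) with hc
  have hc_pos : 0 < c := by positivity
  have hc_le : c ≤ 1 := by
    have : δ ^ 9 * κ ≤ 1 * 4 :=
      mul_le_mul (pow_le_one₀ hδ.le hδ1.le) (hdist.lt_four hp).le hκ.le zero_le_one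
    rw [hc]
    linarith
  have hwδ : |p.angularVelocity r θ| ≤ 3 / 250 * (δ * c) := by rw [hc]; linarith
  have hwc : |p.angularVelocity r θ| ≤ 3 / 250 * c := by nlinarith
  have hnorm : ‖(r : ℂ) * Complex.exp (Complex.I * θ)‖ = r := by
    rw [norm_mul, Complex.norm_exp_I_mul_ofReal, mul_one, Complex.norm_of_nonneg hr.le]
  have hr_ge : 1 / 8 ≤ r := hp.eighth_le_of_abs_angularVelocity_le (θ := θ) hr.le (by linarith)
  have hrδ : r * δ ≤ 1 := by
    have hr_le := htame.1
    rwa [hnorm, ← one_div, le_div_iff₀ hδ] at hr_le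
  have hlower : c ≤ |p.radialRate r θ| + |p.angularVelocity r θ| := by
    have hspeed := hp.le_norm_logVel hδ hδ1 hκ.le hdist htame (hnorm.symm ▸ hr_ge)
    rw [p.logVel_polar hr.ne'] at hspeed
    exact hspeed.trans (Complex.norm_le_abs_re_add_abs_im _)
  have hupper : |p.radialRate r θ| * (1 - |p.angularVelocity r θ|) ≤ 9 / 125 * c := by
    calc |p.radialRate r θ| * (1 - |p.angularVelocity r θ|)
        ≤ 6 * r * |p.angularVelocity r θ| := hp.abs_radialRate_mul_le hr.le hacc
      _ ≤ 6 * r * (3 / 250 * (δ * c)) := by gcongr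
      _ = 9 / 125 * (r * δ) * c := by ring
      _ ≤ 9 / 125 * 1 * c := by gcongr
      _ = 9 / 125 * c := by ring
  nlinarith [abs_nonneg (p.radialRate r θ)]

theorem InPolydisc.im_logVel_le_of_mem_strip (hp : p.InPolydisc) {δ β : ℝ} (hβ : 0 ≤ β) {z : ℂ}
    (hz : z ∈ p.strip δ β) (hz0 : z ≠ 0) : (p.logVel z).im ≤ 4 * β := by
  obtain ⟨-, r, θ, hr, rfl, hg, hlow, hupp⟩ := hz
  have hr_ne : r ≠ 0 := by rintro rfl; simp at hz0
  have hg_neg : p.g θ < 0 := by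
    by_contra! hg_nonneg
    have : -1 / p.g θ ≤ 0 := div_nonpos_of_nonpos_of_nonneg (by norm_num) hg_nonneg
    exact hr_ne (le_antisymm (hupp.trans this) hr)
  rw [p.logVel_polar hr_ne]
  calc 1 + r * p.g θ ≤ 1 + (-1 / p.g θ - β) * p.g θ := by
        gcongr 1 + ?_
        exact mul_le_mul_of_nonpos_right hlow hg_neg.le
    _ = β * -p.g θ := by field_simp; ring
    _ ≤ β * 4 := by gcongr; linarith [(abs_le.mp (hp.abs_g_le θ)).1]
    _ = 4 * β := mul_comm _ _

theorem strip_subset_strip (p : QuadParam) (δ : ℝ) {β β' : ℝ} (hβ : β ≤ β') :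
    p.strip δ β ⊆ p.strip δ β' := by
  rintro z ⟨hz, r, θ, hr, hzr, hg, hlow, hupp⟩
  exact ⟨hz, r, θ, hr, hzr, hg, by linarith, hupp⟩

end QuadParam

section IntegralCurves

theorem exists_log_lift {γ v : ℝ → ℂ} (hv : Continuous v) (hγ : ∀ t, HasDerivAt γ (v t) t)
    (hγ0 : ∀ t, γ t ≠ 0) :
    ∃ l : ℝ → ℂ, (∀ t, γ t = Complex.exp (l t)) ∧ ∀ t, HasDerivAt l (v t / γ t) t := by
  have hγc : Continuous γ := continuous_iff_continuousAt.mpr fun t => (hγ t).continuousAt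
  set l : ℝ → ℂ := fun u => Complex.log (γ 0) + ∫ x in (0 : ℝ)..u, v x / γ x with hl
  have hl' (t : ℝ) : HasDerivAt l (v t / γ t) t :=
    ((hv.div hγc hγ0).integral_hasStrictDerivAt 0 t).hasDerivAt.const_add _
  refine ⟨l, fun t => ?_, hl'⟩
  have hquot (t : ℝ) : HasDerivAt (fun u => γ u * Complex.exp (-l u)) 0 t := by
    refine ((hγ t).mul (hl' t).neg.cexp).congr_deriv ?_
    have := hγ0 t
    simp only [Pi.neg_apply]
    field_simp
    ring
  have hconst : γ t * Complex.exp (-l t) = γ 0 * Complex.exp (-l 0) :=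
    is_const_of_deriv_eq_zero (fun t => (hquot t).differentiableAt) (fun t => (hquot t).deriv) t 0
  have hl0 : Complex.exp (l 0) = γ 0 := by
    simp only [hl, intervalIntegral.integral_same, add_zero, Complex.exp_log (hγ0 0)]
  rw [Complex.exp_neg, Complex.exp_neg, hl0, mul_inv_cancel₀ (hγ0 0)] at hconst
  exact eq_of_mul_inv_eq_one hconst

theorem periodic_of_integralCurve_eq {E : Type*} [NormedAddCommGroup E] [NormedSpace ℝ E]
    [CompleteSpace E] {v : E → E} (hv : ContDiff ℝ 1 v) {γ : ℝ → E}
    (hγ : ∀ t, HasDerivAt γ (v (γ t)) t) {s t : ℝ} (hst : γ s = γ t) :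
    Function.Periodic γ (s - t) := by
  have hcurve : IsMIntegralCurve (I := modelWithCornersSelf ℝ E) γ v := fun t =>
    (hγ t).hasFDerivAt.hasMFDerivAt
  exact hcurve.periodic_of_eq (contMDiff_vectorSpace_iff_contDiff.mpr hv) hst

theorem Surrounds.exists_mem_ray {L : Set ℂ} (hL : Surrounds L 0) (θ : ℝ) :
    ∃ r : ℝ, 0 < r ∧ (r : ℂ) * Complex.exp (Complex.I * θ) ∈ L := by
  by_contra! hmiss
  set ray : ℝ → ℂ := fun r => (r : ℂ) * Complex.exp (Complex.I * θ)
  have hray : Continuous ray := by fun_prop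
  have hsub : ray '' Set.Ici 0 ⊆ Lᶜ := by
    rintro _ ⟨r, hr, rfl⟩ hrL
    rcases (Set.mem_Ici.mp hr).eq_or_lt with rfl | hr
    · exact hL.1 (by simpa [ray] using hrL)
    · exact hmiss r hr hrL
  have hbdd : Bornology.IsBounded (ray '' Set.Ici 0) :=
    hL.2.subset (((convex_Ici (0 : ℝ)).isPreconnected.image ray
      hray.continuousOn).subset_connectedComponentIn ⟨0, Set.self_mem_Ici, by simp [ray]⟩ hsub)
  obtain ⟨M, hM⟩ := hbdd.exists_norm_le
  have hray_le := hM (ray (|M| + 1)) ⟨_, Set.mem_Ici.mpr (by positivity), rfl⟩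
  rw [norm_mul, Complex.norm_exp_I_mul_ofReal, mul_one,
    Complex.norm_of_nonneg (by positivity)] at hray_le
  linarith [le_abs_self M]

end IntegralCurves

namespace QuadParam

theorem contDiff_field (p : QuadParam) : ContDiff ℝ 1 p.field := by
  have hconj : ContDiff ℝ 1 (fun z : ℂ => conj z) := Complex.conjCLE.contDiff
  unfold field
  fun_prop

/-- Radius and angle functions `r > 0` and `θ` representing a solution `γ` of the field `p` as
`r e^{iθ}`, for all times, and solving the field's equations in polar coordinates. -/
structure IsPolarLift (p : QuadParam) (γ : ℝ → ℂ) (r θ : ℝ → ℝ) : Prop where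
  radius_pos : ∀ t, 0 < r t
  eq_polar : ∀ t, γ t = r t * Complex.exp (Complex.I * θ t)
  hasDerivAt_radius : ∀ t, HasDerivAt r (r t * p.radialRate (r t) (θ t)) t
  hasDerivAt_angle : ∀ t, HasDerivAt θ (p.angularVelocity (r t) (θ t)) t

theorem exists_isPolarLift {p : QuadParam} {γ : ℝ → ℂ} (hγ : ∀ t, HasDerivAt γ (p.field (γ t)) t)
    (hγ0 : ∀ t, γ t ≠ 0) : ∃ r θ : ℝ → ℝ, p.IsPolarLift γ r θ := by
  have hγc : Continuous γ := continuous_iff_continuousAt.mpr fun t => (hγ t).continuousAt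
  obtain ⟨l, hl, hl'⟩ := exists_log_lift (p.contDiff_field.continuous.comp hγc) hγ hγ0
  set r : ℝ → ℝ := fun t => Real.exp (l t).re
  have hr (t : ℝ) : 0 < r t := Real.exp_pos _
  have hpolar (t : ℝ) : γ t = r t * Complex.exp (Complex.I * (l t).im) := by
    rw [hl t, Complex.ofReal_exp, ← Complex.exp_add, mul_comm Complex.I, Complex.re_add_im]
  have hrate (t : ℝ) : HasDerivAt l
      ⟨p.radialRate (r t) (l t).im, p.angularVelocity (r t) (l t).im⟩ t := by
    rw [← p.logVel_polar (hr t).ne', ← hpolar t]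
    exact hl' t
  refine ⟨r, fun t => (l t).im, hr, hpolar, fun t => ?_, fun t => ?_⟩
  · exact (Complex.reCLM.hasFDerivAt.comp_hasDerivAt t (hrate t) :).exp
  · exact (Complex.imCLM.hasFDerivAt.comp_hasDerivAt t (hrate t) :)

namespace IsPolarLift

variable {p : QuadParam} {γ : ℝ → ℂ} {r θ : ℝ → ℝ}

theorem continuous_radius (hl : p.IsPolarLift γ r θ) : Continuous r :=
  continuous_iff_continuousAt.mpr fun t => (hl.hasDerivAt_radius t).continuousAt

theorem hasDerivAt_angularVelocity (hl : p.IsPolarLift γ r θ) (t : ℝ) :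
    HasDerivAt (fun t => p.angularVelocity (r t) (θ t)) (p.angularAcceleration (r t) (θ t)) t :=
  ((hl.hasDerivAt_radius t).mul
    ((p.hasDerivAt_g (θ t)).comp t (hl.hasDerivAt_angle t))).const_add 1

theorem im_logVel (hl : p.IsPolarLift γ r θ) (t : ℝ) :
    (p.logVel (γ t)).im = p.angularVelocity (r t) (θ t) := by
  rw [hl.eq_polar t, p.logVel_polar (hl.radius_pos t).ne']

theorem periodic_angularVelocity (hl : p.IsPolarLift γ r θ) {τ : ℝ} (hγ : Function.Periodic γ τ) :
    Function.Periodic (fun t => p.angularVelocity (r t) (θ t)) τ := fun t => by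
  simp only [← hl.im_logVel, hγ t]

theorem angle_add_sub_angle (hl : p.IsPolarLift γ r θ) {τ : ℝ} (hγ : Function.Periodic γ τ)
    (s t : ℝ) : θ (t + τ) - θ t = θ (s + τ) - θ s := by
  have hderiv (t : ℝ) : HasDerivAt (fun t => θ (t + τ) - θ t) 0 t := by
    have := ((hl.hasDerivAt_angle (t + τ)).comp_add_const t τ).sub (hl.hasDerivAt_angle t)
    exact this.congr_deriv (sub_eq_zero.mpr (hl.periodic_angularVelocity hγ t))
  exact is_const_of_deriv_eq_zero (fun t => (hderiv t).differentiableAt)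
    (fun t => (hderiv t).deriv) t s

theorem exists_g_angle_eq_zero (hl : p.IsPolarLift γ r θ) (h0 : Surrounds (Set.range γ) 0) :
    ∃ a, p.g (θ a) = 0 := by
  obtain ⟨φ, hφ⟩ := p.exists_g_eq_zero
  obtain ⟨q, hq, a, ha⟩ := h0.exists_mem_ray φ
  have hone : p.angularVelocity (r a) (θ a) = 1 := by
    rw [← hl.im_logVel, ha, p.logVel_polar hq.ne']
    exact angularVelocity_eq_one hφ
  exact ⟨a, (mul_eq_zero.mp (add_eq_left.mp hone)).resolve_left (hl.radius_pos a).ne'⟩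

theorem angle_lt_angle (hl : p.IsPolarLift γ r θ) {a t : ℝ} (ha : p.g (θ a) = 0) (hat : a < t) :
    θ a < θ t :=
  lt_of_hasDerivAt_pos_on_level hl.hasDerivAt_angle
    (fun t ht => by rw [ht, angularVelocity_eq_one ha]; exact one_pos) le_rfl hat

theorem angle_lt_angle_add (hl : p.IsPolarLift γ r θ) {a τ : ℝ} (ha : p.g (θ a) = 0)
    (hγ : Function.Periodic γ τ) (hτ : 0 < τ) (t : ℝ) : θ t < θ (t + τ) :=
  sub_pos.mp (hl.angle_add_sub_angle hγ a t ▸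
    sub_pos.mpr (hl.angle_lt_angle ha (lt_add_of_pos_right a hτ)))

theorem injective (hl : p.IsPolarLift γ r θ) (hγ : ∀ t, HasDerivAt γ (p.field (γ t)) t) {a : ℝ}
    (ha : p.g (θ a) = 0) : Function.Injective fun t => (θ t, r t) := by
  refine Function.Injective.of_lt_imp_ne fun s t hst heq => ?_
  obtain ⟨hθ, hr⟩ := Prod.mk.inj heq
  have hγst : γ t = γ s := by rw [hl.eq_polar, hl.eq_polar, hθ, hr]
  have hlt := hl.angle_lt_angle_add ha (periodic_of_integralCurve_eq p.contDiff_field hγ hγst)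
    (sub_pos.mpr hst) s
  rw [add_sub_cancel] at hlt
  exact hlt.ne hθ

theorem angularVelocity_pos (hl : p.IsPolarLift γ r θ)
    (hγ : ∀ t, HasDerivAt γ (p.field (γ t)) t) {T : ℝ} (hT : 0 < T) (hper : Function.Periodic γ T)
    (h0 : Surrounds (Set.range γ) 0)
    (hreg : ∀ t, p.angularVelocity (r t) (θ t) = 0 → p.angularAcceleration (r t) (θ t) ≠ 0)
    (t : ℝ) : 0 < p.angularVelocity (r t) (θ t) := by
  obtain ⟨a, ha⟩ := hl.exists_g_angle_eq_zero h0
  have hpos_after : ∀ t, a ≤ t → 0 < p.angularVelocity (r t) (θ t) := fun t hat =>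
    angularVelocity_pos_of_forall_lt hl.hasDerivAt_angle hl.hasDerivAt_angularVelocity
      hl.continuous_radius (hl.injective hγ ha)
      (fun s t hθ hr hw => hθ ▸ angularVelocity_neg_of_lt (hl.radius_pos s) hr hw) hreg
      ((angularVelocity_eq_one ha).symm ▸ one_pos) (fun t => hl.angle_lt_angle ha)
      (fun t => ⟨t + T, lt_add_of_pos_right t hT, (hl.angle_lt_angle_add ha hper hT t).le⟩) hat
  obtain ⟨n, hn⟩ := exists_nat_gt ((a - t) / T)
  rw [div_lt_iff₀ hT] at hn
  have hshift : p.angularVelocity (r (t + n * T)) (θ (t + n * T)) = p.angularVelocity (r t) (θ t) :=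
    (hl.periodic_angularVelocity hper).nat_mul n t
  exact hshift ▸ hpos_after _ (by linarith)

theorem lt_angularVelocity (hl : p.IsPolarLift γ r θ)
    (hγ : ∀ t, HasDerivAt γ (p.field (γ t)) t) {T : ℝ} (hT : 0 < T) (hper : Function.Periodic γ T)
    (h0 : Surrounds (Set.range γ) 0) {ε : ℝ} (hε : 0 ≤ ε)
    (hreg : ∀ t, |p.angularVelocity (r t) (θ t)| ≤ ε → p.angularAcceleration (r t) (θ t) ≠ 0)
    (t : ℝ) : ε < p.angularVelocity (r t) (θ t) := by
  have hpos := hl.angularVelocity_pos hγ hT hper h0 fun t ht =>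
    hreg t (by rwa [ht, abs_zero])
  have hcont : Continuous fun t => p.angularVelocity (r t) (θ t) :=
    continuous_iff_continuousAt.mpr fun t => (hl.hasDerivAt_angularVelocity t).continuousAt
  obtain ⟨_, ⟨m, rfl⟩, hleast⟩ := ((hl.periodic_angularVelocity hper).compact_of_continuous hT.ne'
    hcont).exists_isLeast (Set.range_nonempty _)
  have hmin (t : ℝ) : p.angularVelocity (r m) (θ m) ≤ p.angularVelocity (r t) (θ t) :=
    hleast ⟨t, rfl⟩
  have hstationary : p.angularAcceleration (r m) (θ m) = 0 :=
    IsLocalMin.hasDerivAt_eq_zero (Filter.Eventually.of_forall hmin)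
      (hl.hasDerivAt_angularVelocity m)
  by_contra! hle
  exact hreg m ((abs_of_pos (hpos m)).trans_le ((hmin t).trans hle)) hstationary

end IsPolarLift

end QuadParam

theorem mainTheorem4_general (p : QuadParam) (hp : p.InPolydisc) (δ κ : ℝ) (hδ : 0 < δ)
    (hδ1 : δ < 1) (hκ : 0 < κ) (hdist : p.IsDistantFromSingular κ) (L : Set ℂ)
    (hL : IsClosedOrbit p.field L) (htame : L ⊆ p.tameDomain δ) (h0 : Surrounds L 0) :
    Disjoint L (p.strip δ (δ ^ 10 * κ / 10 ^ 10)) := by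
  obtain ⟨γ, T, hT, hγ, hper, -, rfl⟩ := hL
  have hγ0 (t : ℝ) : γ t ≠ 0 := fun ht => h0.1 ⟨t, ht⟩
  obtain ⟨r, θ, hl⟩ := QuadParam.exists_isPolarLift hγ hγ0
  have hfast (t : ℝ) : 4 * (δ ^ 10 * κ / 10 ^ 10) < p.angularVelocity (r t) (θ t) :=
    hl.lt_angularVelocity hγ hT hper h0 (by positivity)
      (fun t => hp.angularAcceleration_ne_zero hδ hδ1 hκ hdist (hl.radius_pos t)
        (hl.eq_polar t ▸ htame ⟨t, rfl⟩)) t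
  rw [Set.disjoint_left]
  rintro _ ⟨t, rfl⟩ hstrip
  have hslow := hp.im_logVel_le_of_mem_strip (by positivity) hstrip (hγ0 t)
  rw [hl.im_logVel] at hslow
  exact (hfast t).not_ge hslow

theorem mainTheorem4 (p : QuadParam) (hp : p.IsNormalized) (δ κ : ℝ)
    (hδ : 0 < δ) (hδ1 : δ < 1) (hκ : 0 < κ) (hdist : p.IsDistantFromSingular κ)
    (L : Set ℂ) (hL : IsTameLimitCycle p δ L) (h0 : Surrounds L 0) :
    Disjoint L (p.strip δ (δ ^ 14 * κ / 10 ^ 10)) :=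
  (mainTheorem4_general p hp.inPolydisc δ κ hδ hδ1 hκ hdist L hL.1.1 hL.2 h0).mono_right <|
    p.strip_subset_strip δ (by gcongr ?_ * _ / _; exact pow_le_pow_of_le_one hδ.le hδ1.le (by simp))
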